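/- Let $K\subset\mathbb R^4$ be a star body, i.e. a compact set with the origin in its interior such that every line through the origin meets the boundary of $K$ in exactly two points different from the origin, and let $\|x\|_K=\min\{a\ge 0: x\in aK\}$ be its Minkowski functional. Suppose that $K$ is contained in the open Euclidean unit ball $\{x\in\mathbb R^4:|x|<1\}$ and that $K$ is $R_\theta$-invariant, i.e. for every $\theta\in[0,2\pi]$ and every $\xi=(\xi_{11},\xi_{12},\xi_{21},\xi_{22})\in\mathbb R^4$, $$\|\xi\|_K=\|(R_\theta(\xi_{11},\xi_{12}),R_\theta(\xi_{21},\xi_{22}))\|_K,$$ where $R_\theta$ is the counterclockwise rotation of $\mathbb R^2$ by the angle $\theta$ about the origin. Then the function $$f(x)=\frac{\|x\|_K^{-2}}{1-\left(\frac{|x|}{\|x\|_K}\right)^2}$$ defines, by $\langle f,\varphi\rangle=\int_{\mathbb R^4}f(x)\varphi(x)\,dx$ (the integrals converging absolutely), a tempered distribution on $\mathbb R^4$, and this distribution is positive definite: for every complex-valued Schwartz function $\varphi$ on $\mathbb R^4$, $$\left\langle f,\ \varphi*\overline{\varphi(-\,\cdot\,)}\right\rangle\ \ge\ 0 .$$ 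-/

import Mathlib

open MeasureTheory
open scoped SchwartzMap ComplexOrder ComplexConjugate Convolution

noncomputable section

/-- The space `ℝ⁴ ≅ ℂ²`, with coordinates `(ξ₁₁, ξ₁₂, ξ₂₁, ξ₂₂)` standing for
`(ξ₁₁ + i ξ₁₂, ξ₂₁ + i ξ₂₂)`, and with the Euclidean norm. -/
abbrev R4 : Type := EuclideanSpace ℝ (Fin 4)

/-- A star body: a compact set having the origin in its interior, such that every line through
the origin meets the boundary in exactly two points different from the origin. -/
structure IsStarBody {E : Type*} [NormedAddCommGroup E] [NormedSpace ℝ E] (K : Set E) : Prop where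
  isCompact : IsCompact K
  zero_mem_interior : (0 : E) ∈ interior K
  ncard_line_inter_frontier : ∀ v : E, v ≠ 0 →
    {y : E | y ∈ frontier K ∧ y ∈ Submodule.span ℝ {v} ∧ y ≠ 0}.ncard = 2

/-- Simultaneous counterclockwise rotation by the angle `θ` in the two coordinate planes
of `ℝ⁴ = ℝ² × ℝ²`. -/
def rotTheta (θ : ℝ) (x : R4) : R4 :=
  !₂[Real.cos θ * x 0 - Real.sin θ * x 1, Real.sin θ * x 0 + Real.cos θ * x 1,
     Real.cos θ * x 2 - Real.sin θ * x 3, Real.sin θ * x 2 + Real.cos θ * x 3]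

/-- `R_θ`-invariance of a body in `ℝ⁴`, in terms of its Minkowski functional `gauge K`. -/
def IsRThetaInvariant (K : Set R4) : Prop :=
  ∀ θ ∈ Set.Icc (0 : ℝ) (2 * Real.pi), ∀ x : R4, gauge K (rotTheta θ x) = gauge K x

/-- The function `x ↦ ‖x‖_K⁻² / (1 - (|x| / ‖x‖_K)²)`. -/
def hyperbolicDensity (K : Set R4) (x : R4) : ℝ :=
  (gauge K x) ^ (-2 : ℤ) / (1 - (‖x‖ / gauge K x) ^ 2)

section PositiveDefinite

variable {E : Type*} [NormedAddCommGroup E] [InnerProductSpace ℝ E]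

/-- The test function `x ↦ conj (φ (-x))`. -/
def conjReflection (φ : 𝓢(E, ℂ)) : 𝓢(E, ℂ) :=
  SchwartzMap.postcompCLM (Complex.conjCLE : ℂ →L[ℝ] ℂ)
    (SchwartzMap.compCLMOfContinuousLinearEquiv ℝ (ContinuousLinearEquiv.neg ℝ) φ)

theorem conjReflection_apply (φ : 𝓢(E, ℂ)) (x : E) :
    conjReflection φ x = conj (φ (-x)) := rfl

variable [FiniteDimensional ℝ E] [MeasurableSpace E] [BorelSpace E]

/-- The test function `φ ∗ conj (φ (-·))`. -/
def autoConvolution (φ : 𝓢(E, ℂ)) : 𝓢(E, ℂ) :=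
  SchwartzMap.convolution (ContinuousLinearMap.mul ℂ ℂ) φ (conjReflection φ)

theorem autoConvolution_apply (φ : 𝓢(E, ℂ)) (x : E) :
    autoConvolution φ x = ∫ y, φ y * conj (φ (y - x)) := by
  simp [autoConvolution, SchwartzMap.convolution_apply, convolution, conjReflection_apply]

/-- A tempered distribution `T` is positive definite if `⟨T, φ ∗ conj (φ (-·))⟩ ≥ 0` for every
test function `φ`; here `0 ≤ z` for `z : ℂ` says that `z` is real and nonnegative. -/
def IsPositiveDefiniteDistribution (T : 𝓢'(E, ℂ)) : Prop :=
  ∀ φ : 𝓢(E, ℂ), 0 ≤ T (autoConvolution φ)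

/-- The tempered distribution `T` is given by integration against the function `f`. -/
def IsRepresentedBy (T : 𝓢'(E, ℂ)) (f : E → ℝ) : Prop :=
  ∀ φ : 𝓢(E, ℂ), Integrable (fun x => (f x : ℂ) * φ x) ∧ T φ = ∫ x, (f x : ℂ) * φ x

end PositiveDefinite

end

/-! Let `V` act on `E` by maps `A v` with `|A v x| = |v| |x|`, let `d = dim V` and `N = dim E`, and
let `f ≥ 0` satisfy `f (A v x) = |v| ^ (d - N) f x`. Integrated against a test function `ψ`, such an
`f` is an average of the integrals of `ψ` over the subspaces `A V x`: with the kernel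
`k (r, s) = s ^ (-d) 1_{r ≤ s}`, the substitution `y = A v x` gives
`∫ k (1, |x|) f x (∫ ψ (A v x) dv) dx = ∫ f y ψ y (∫ k (|v|, |y|) dv) dy`,
and the inner integral on the right is the volume of the unit ball of `V`. For
`ψ = φ ∗ conj (φ (-·))`, the integral of `ψ` over a subspace is the integral of `|a|²`, where `a` is
the integral of `φ` over the translates of that subspace.

The density equals `(‖x‖_K² - |x|²)⁻¹`, and `R_θ`-invariance makes it homogeneous under the scalar
action of `ℂ` on `ℝ⁴ ≅ ℂ²`, so the above applies with `d = 2` and `N = 4`. It is a tempered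
distribution because it is `O(|x|⁻²)`. -/

section Slices

variable {V W : Type*} [NormedAddCommGroup V] [NormedSpace ℝ V] [FiniteDimensional ℝ V]
  [MeasurableSpace V] [BorelSpace V] [NormedAddCommGroup W] [NormedSpace ℝ W]

theorem exists_integrable_norm_slice_le (μ : Measure V) [μ.IsAddHaarMeasure] (Φ : 𝓢(V × W, ℂ)) :
    ∃ g : V → ℝ, Continuous g ∧ Integrable g μ ∧ ∀ v w, ‖Φ (v, w)‖ ≤ g v := by
  let k := Module.finrank ℝ V + 1
  let C := 2 ^ k * (Finset.Iic (k, 0)).sup (fun m => SchwartzMap.seminorm ℝ m.1 m.2) Φ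
  have hdecay (p : V × W) : (1 + ‖p‖) ^ k * ‖Φ p‖ ≤ C := by
    simpa only [norm_iteratedFDeriv_zero] using
      SchwartzMap.one_add_le_sup_seminorm_apply (𝕜 := ℝ) (m := (k, 0)) le_rfl le_rfl Φ p
  refine ⟨fun v => C * (1 + ‖v‖) ^ (-(k : ℝ)), ?_,
    (integrable_one_add_norm (by push_cast [k]; linarith)).const_mul C, fun v w => ?_⟩
  · exact continuous_const.mul <| (continuous_const.add continuous_norm).rpow_const
      fun v => .inl (by positivity : 1 + ‖v‖ ≠ 0)
  · beta_reduce
    rw [Real.rpow_neg (by positivity), Real.rpow_natCast, ← div_eq_mul_inv,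
      le_div_iff₀' (by positivity)]
    refine le_trans ?_ (hdecay (v, w))
    gcongr
    exact norm_fst_le (v, w)

variable {μ : Measure V} [μ.IsAddHaarMeasure]
  [FiniteDimensional ℝ W] [MeasurableSpace W] [BorelSpace W] {ν : Measure W} [ν.IsAddHaarMeasure]

theorem integrable_mul_conj_shift (Φ : 𝓢(V × W, ℂ)) :
    Integrable (fun q : V × (V × W) => Φ q.2 * conj (Φ (q.2 - (q.1, 0)))) (μ.prod (μ.prod ν)) := by
  obtain ⟨g, hgc, hg, hΦ⟩ := exists_integrable_norm_slice_le μ Φ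
  have hbound : Integrable (fun q : V × (V × W) => ‖Φ q.2‖ * g (q.2.1 - q.1))
      (μ.prod (μ.prod ν)) := by
    refine (integrable_prod_iff' (by fun_prop)).2
      ⟨.of_forall fun p => (hg.comp_sub_left p.1).const_mul ‖Φ p‖, ?_⟩
    simp only [norm_mul, norm_norm, integral_const_mul,
      integral_sub_left_eq_self (fun v => ‖g v‖) μ]
    exact Φ.integrable.norm.mul_const _
  refine hbound.mono' (by fun_prop) (.of_forall fun q => ?_)
  rw [norm_mul, RCLike.norm_conj]
  gcongr
  exact hΦ _ _

-- With `a w = ∫ v, Φ (v, w)`, the integral below is `∫ w, |a w|²`.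
theorem integral_mul_conj_shift_nonneg (Φ : 𝓢(V × W, ℂ)) :
    0 ≤ ∫ v, ∫ p, Φ p * conj (Φ (p - (v, 0))) ∂(μ.prod ν) ∂μ := by
  have hint := integrable_mul_conj_shift (μ := μ) (ν := ν) Φ
  have hslice (p : V × W) : ∫ v, Φ p * conj (Φ (p - (v, 0))) ∂μ =
      Φ p * conj (∫ v, Φ (v, p.2) ∂μ) := by
    rw [integral_const_mul, integral_conj, ← integral_sub_left_eq_self (fun v => Φ (v, p.2)) μ p.1]
    simp only [Prod.sub_def, sub_zero]
  have hint' := hint.integral_prod_right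
  simp only [hslice] at hint'
  calc 0 ≤ ∫ w, (∫ v, Φ (v, w) ∂μ) * conj (∫ v, Φ (v, w) ∂μ) ∂ν :=
        integral_nonneg fun w => mul_star_self_nonneg _
    _ = ∫ p, Φ p * conj (∫ v, Φ (v, p.2) ∂μ) ∂(μ.prod ν) := by
        rw [integral_prod_symm _ hint']
        simp only [integral_mul_const]
    _ = ∫ v, ∫ p, Φ p * conj (Φ (p - (v, 0))) ∂(μ.prod ν) ∂μ := by
        rw [integral_integral_swap hint]
        simp only [hslice]

end Slices

section Subspaces

variable {V E : Type*} [NormedAddCommGroup V] [NormedSpace ℝ V] [FiniteDimensional ℝ V]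

theorem exists_complement_equiv_prod [NormedAddCommGroup E] [NormedSpace ℝ E]
    [FiniteDimensional ℝ E] {L : V →ₗ[ℝ] E} (hL : Function.Injective L) :
    ∃ (W : Submodule ℝ E) (e : (V × W) ≃L[ℝ] E), ∀ v, e (v, 0) = L v := by
  obtain ⟨W, hW⟩ := (LinearMap.range L).exists_isCompl
  let e := ((LinearEquiv.ofInjective L hL).prodCongr (.refl ℝ W)).trans
    (Submodule.prodEquivOfIsCompl _ _ hW)
  exact ⟨W, e.toContinuousLinearEquiv, fun v => by simp [e]⟩

variable [MeasurableSpace V] [BorelSpace V] {μ : Measure V} [μ.IsAddHaarMeasure]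
  [NormedAddCommGroup E] [InnerProductSpace ℝ E] [FiniteDimensional ℝ E] [MeasurableSpace E]
  [BorelSpace E]

theorem integral_autoConvolution_comp_nonneg (φ : 𝓢(E, ℂ)) {L : V →ₗ[ℝ] E}
    (hL : Function.Injective L) : 0 ≤ ∫ v, autoConvolution φ (L v) ∂μ := by
  obtain ⟨W, e, he⟩ := exists_complement_equiv_prod hL
  let Φ : 𝓢(V × W, ℂ) := SchwartzMap.compCLMOfContinuousLinearEquiv ℝ e φ
  let c := Measure.addHaarScalarFactor volume ((μ.prod volume).map e)
  have hvol : (volume : Measure E) = c • (μ.prod volume).map e :=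
    Measure.isAddLeftInvariant_eq_smul _ _
  have hshift (v : V) : autoConvolution φ (L v) =
      (c : ℝ) • ∫ p, Φ p * conj (Φ (p - (v, 0))) ∂(μ.prod volume) := by
    have hemb : MeasurableEmbedding e := e.toHomeomorph.measurableEmbedding
    rw [autoConvolution_apply, hvol, integral_smul_nnreal_measure, hemb.integral_map,
      NNReal.smul_def]
    simp [Φ, ← he]
  simp_rw [hshift, integral_smul]
  exact smul_nonneg c.2 (integral_mul_conj_shift_nonneg Φ)

end Subspaces

section Similarities

variable {E : Type*} [NormedAddCommGroup E] [InnerProductSpace ℝ E] [FiniteDimensional ℝ E]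
  {L : E →ₗ[ℝ] E} {c : ℝ}

theorem abs_det_eq_pow_finrank (hc : 0 < c) (hL : ∀ x, ‖L x‖ = c * ‖x‖) :
    |LinearMap.det L| = c ^ Module.finrank ℝ E := by
  let U : E →ₗᵢ[ℝ] E :=
    ⟨c⁻¹ • L, fun x => by simp [norm_smul, hL, abs_of_pos hc, hc.ne']⟩
  have hLU : L = c • U.toLinearMap := (smul_inv_smul₀ hc.ne' L).symm
  rw [← LinearMap.normDet_eq_abs_det, hLU, LinearMap.normDet_smul, U.normDet_eq_one, mul_one,
    Real.norm_of_nonneg hc.le]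

variable [MeasurableSpace E] [BorelSpace E]

theorem map_volume_eq_smul_of_norm_map (hc : 0 < c) (hL : ∀ x, ‖L x‖ = c * ‖x‖) :
    Measure.map L volume = ENNReal.ofReal (c ^ Module.finrank ℝ E)⁻¹ • volume := by
  have hdet := abs_det_eq_pow_finrank hc hL
  have hdet0 : LinearMap.det L ≠ 0 := by
    rw [← abs_pos, hdet]
    positivity
  rw [Measure.map_linearMap_addHaar_eq_smul_addHaar _ hdet0, abs_inv, hdet]

variable {F : Type*} [NormedAddCommGroup F]

theorem integrable_comp_of_norm_map (hc : 0 < c) (hL : ∀ x, ‖L x‖ = c * ‖x‖) {h : E → F}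
    (hh : Integrable h) : Integrable fun x => h (L x) := by
  refine Integrable.comp_measurable (g := h) ?_ L.continuous_of_finiteDimensional.measurable
  rw [map_volume_eq_smul_of_norm_map hc hL]
  exact hh.smul_measure ENNReal.ofReal_ne_top

theorem pow_finrank_smul_integral_comp_of_norm_map [NormedSpace ℝ F] (hc : 0 < c)
    (hL : ∀ x, ‖L x‖ = c * ‖x‖) (h : E → F) :
    c ^ Module.finrank ℝ E • ∫ x, h (L x) = ∫ x, h x := by
  have hinj : Function.Injective L := by
    refine (injective_iff_map_eq_zero L).2 fun x hx => ?_
    simpa [hx, hc.ne'] using hL x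
  have hemb : MeasurableEmbedding L :=
    (LinearMap.isClosedEmbedding_of_injective (LinearMap.ker_eq_bot.2 hinj)).measurableEmbedding
  rw [← hemb.integral_map, map_volume_eq_smul_of_norm_map hc hL, integral_smul_measure,
    ENNReal.toReal_ofReal (by positivity), smul_inv_smul₀ (by positivity)]

end Similarities

section ScaleKernel

/-- The kernel `s⁻ᵈ 1_{r ≤ s}`, homogeneous of degree `-d` in `(r, s)`. With `r = ‖v‖` for `v` in a
`d`-dimensional space, its integral over `v` does not depend on `s > 0`. -/
noncomputable def scaleKernel (d : ℕ) (r s : ℝ) : ℝ :=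
  if r ≤ s then (s ^ d)⁻¹ else 0

theorem scaleKernel_nonneg (d : ℕ) (r : ℝ) {s : ℝ} (hs : 0 ≤ s) : 0 ≤ scaleKernel d r s := by
  unfold scaleKernel
  split_ifs <;> positivity

theorem measurable_scaleKernel {α : Type*} [MeasurableSpace α] {r s : α → ℝ} (hr : Measurable r)
    (hs : Measurable s) (d : ℕ) : Measurable fun a => scaleKernel d (r a) (s a) :=
  Measurable.ite (measurableSet_le hr hs) (by fun_prop) measurable_const

theorem pow_mul_scaleKernel_mul (d : ℕ) {t : ℝ} (ht : 0 < t) (s : ℝ) :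
    t ^ d * scaleKernel d t (t * s) = scaleKernel d 1 s := by
  unfold scaleKernel
  simp only [le_mul_iff_one_le_right ht]
  split_ifs
  · rw [mul_pow, mul_inv, mul_inv_cancel_left₀ (by positivity)]
  · exact mul_zero _

theorem scaleKernel_norm_eq_indicator {V : Type*} [SeminormedAddCommGroup V] (d : ℕ) (s : ℝ) :
    (fun v : V => scaleKernel d ‖v‖ s) =
      (Metric.closedBall 0 s).indicator fun _ => (s ^ d)⁻¹ := by
  ext v
  simp [scaleKernel, Set.indicator]

variable {V : Type*} [NormedAddCommGroup V] [NormedSpace ℝ V] [FiniteDimensional ℝ V]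
  [MeasurableSpace V] [BorelSpace V] {μ : Measure V} [μ.IsAddHaarMeasure]

theorem integrable_scaleKernel_norm (d : ℕ) (s : ℝ) :
    Integrable (fun v => scaleKernel d ‖v‖ s) μ := by
  rw [scaleKernel_norm_eq_indicator]
  exact (integrable_indicator_iff measurableSet_closedBall).2
    (integrableOn_const measure_closedBall_lt_top.ne)

theorem integral_scaleKernel_norm {s : ℝ} (hs : 0 < s) :
    ∫ v, scaleKernel (Module.finrank ℝ V) ‖v‖ s ∂μ = μ.real (Metric.ball 0 1) := by
  rw [scaleKernel_norm_eq_indicator, integral_indicator_const _ measurableSet_closedBall,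
    Measure.addHaar_real_closedBall _ _ hs.le, smul_eq_mul, mul_right_comm,
    mul_inv_cancel₀ (by positivity), one_mul]

variable {E F : Type*} [NormedAddCommGroup E] [MeasurableSpace E] [BorelSpace E]
  {ν : Measure E} [SFinite ν] [NullSingletonClass ν]
  [NormedAddCommGroup F] [NormedSpace ℝ F] {g : E → F}

theorem integrable_scaleKernel_smul (hg : Integrable g ν) :
    Integrable (fun p : V × E => scaleKernel (Module.finrank ℝ V) ‖p.1‖ ‖p.2‖ • g p.2)
      (μ.prod ν) := by
  have hker : Measurable fun p : V × E => scaleKernel (Module.finrank ℝ V) ‖p.1‖ ‖p.2‖ :=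
    measurable_scaleKernel measurable_fst.norm measurable_snd.norm _
  have hmeas : AEStronglyMeasurable
      (fun p : V × E => scaleKernel (Module.finrank ℝ V) ‖p.1‖ ‖p.2‖ • g p.2) (μ.prod ν) :=
    hker.aestronglyMeasurable.smul hg.aestronglyMeasurable.comp_snd
  refine (integrable_prod_iff' hmeas).2
    ⟨.of_forall fun y => (integrable_scaleKernel_norm _ ‖y‖).smul_const (g y), ?_⟩
  refine (hg.norm.const_mul (μ.real (Metric.ball 0 1))).congr ?_
  filter_upwards [Measure.ae_ne ν 0] with y hy
  simp only [norm_smul, Real.norm_of_nonneg (scaleKernel_nonneg _ _ (norm_nonneg y))]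
  rw [integral_mul_const, integral_scaleKernel_norm (norm_pos_iff.2 hy)]

theorem integral_scaleKernel_smul [CompleteSpace F] (hg : Integrable g ν) :
    ∫ v : V, ∫ y, scaleKernel (Module.finrank ℝ V) ‖v‖ ‖y‖ • g y ∂ν ∂μ =
      μ.real (Metric.ball 0 1) • ∫ y, g y ∂ν := by
  rw [integral_integral_swap (integrable_scaleKernel_smul hg), ← integral_smul]
  refine integral_congr_ae ?_
  filter_upwards [Measure.ae_ne ν 0] with y hy
  rw [integral_smul_const, integral_scaleKernel_norm (norm_pos_iff.2 hy)]

end ScaleKernel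

section Homogeneous

variable {V E F : Type*} [NormedAddCommGroup V] [NormedSpace ℝ V]
  [NormedAddCommGroup E] [InnerProductSpace ℝ E] [NormedAddCommGroup F] [NormedSpace ℝ F]
  {A : V →L[ℝ] E →L[ℝ] E} {f : E → ℝ} {ψ : E → F}

theorem scaleKernel_smul_comp_eq (hA : ∀ v x, ‖A v x‖ = ‖v‖ * ‖x‖)
    (hf : ∀ v x, ‖v‖ ^ Module.finrank ℝ E * f (A v x) = ‖v‖ ^ Module.finrank ℝ V * f x)
    {v : V} (hv : v ≠ 0) (x : E) :
    scaleKernel (Module.finrank ℝ V) 1 ‖x‖ • f x • ψ (A v x) =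
      ‖v‖ ^ Module.finrank ℝ E •
        scaleKernel (Module.finrank ℝ V) ‖v‖ ‖A v x‖ • f (A v x) • ψ (A v x) := by
  rw [hA, ← pow_mul_scaleKernel_mul _ (norm_pos_iff.2 hv)]
  simp only [← mul_smul]
  congr 1
  linear_combination -scaleKernel (Module.finrank ℝ V) ‖v‖ (‖v‖ * ‖x‖) * hf v x

variable [FiniteDimensional ℝ V] [Nontrivial V] [MeasurableSpace V] [BorelSpace V]
  {μ : Measure V} [μ.IsAddHaarMeasure]
  [FiniteDimensional ℝ E] [Nontrivial E] [MeasurableSpace E] [BorelSpace E]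

theorem integrable_scaleKernel_smul_comp (hA : ∀ v x, ‖A v x‖ = ‖v‖ * ‖x‖)
    (hf : ∀ v x, ‖v‖ ^ Module.finrank ℝ E * f (A v x) = ‖v‖ ^ Module.finrank ℝ V * f x)
    (hfm : Measurable f) (hψ : Continuous ψ) (hfψ : Integrable fun x => f x • ψ x) :
    Integrable (fun p : V × E =>
        scaleKernel (Module.finrank ℝ V) 1 ‖p.2‖ • f p.2 • ψ (A p.1 p.2))
      (μ.prod volume) := by
  have hG := integrable_scaleKernel_smul (V := V) (μ := μ) hfψ
  have hmeas : AEStronglyMeasurable (fun p : V × E =>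
      scaleKernel (Module.finrank ℝ V) 1 ‖p.2‖ • f p.2 • ψ (A p.1 p.2)) (μ.prod volume) := by
    have hker : Measurable fun p : V × E => scaleKernel (Module.finrank ℝ V) 1 ‖p.2‖ :=
      measurable_scaleKernel measurable_const measurable_snd.norm _
    have hcont : Continuous fun p : V × E => ψ (A p.1 p.2) := by fun_prop
    exact hker.aestronglyMeasurable.smul
      ((hfm.comp measurable_snd).aestronglyMeasurable.smul hcont.aestronglyMeasurable)
  refine (integrable_prod_iff hmeas).2 ⟨?_, hG.integral_norm_prod_left.congr ?_⟩
  · filter_upwards [hG.prod_right_ae, Measure.ae_ne μ 0] with v hGv hv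
    simp only [scaleKernel_smul_comp_eq hA hf hv]
    exact (integrable_comp_of_norm_map (L := (A v : E →ₗ[ℝ] E)) (norm_pos_iff.2 hv) (hA v)
      hGv).smul _
  · filter_upwards [Measure.ae_ne μ 0] with v hv
    simp only [scaleKernel_smul_comp_eq hA hf hv, norm_smul (‖v‖ ^ _), norm_pow, norm_norm,
      integral_const_mul]
    exact (pow_finrank_smul_integral_comp_of_norm_map (L := (A v : E →ₗ[ℝ] E))
      (norm_pos_iff.2 hv) (hA v)
      fun y => ‖scaleKernel (Module.finrank ℝ V) ‖v‖ ‖y‖ • f y • ψ y‖).symm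

theorem integral_scaleKernel_smul_integral_comp [CompleteSpace F]
    (hA : ∀ v x, ‖A v x‖ = ‖v‖ * ‖x‖)
    (hf : ∀ v x, ‖v‖ ^ Module.finrank ℝ E * f (A v x) = ‖v‖ ^ Module.finrank ℝ V * f x)
    (hfm : Measurable f) (hψ : Continuous ψ) (hfψ : Integrable fun x => f x • ψ x) :
    ∫ x, scaleKernel (Module.finrank ℝ V) 1 ‖x‖ • f x • ∫ v, ψ (A v x) ∂μ =
      μ.real (Metric.ball 0 1) • ∫ x, f x • ψ x := by
  rw [← integral_scaleKernel_smul hfψ]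
  simp only [← integral_smul]
  rw [← integral_integral_swap (integrable_scaleKernel_smul_comp hA hf hfm hψ hfψ)]
  refine integral_congr_ae ?_
  filter_upwards [Measure.ae_ne μ 0] with v hv
  simp only [scaleKernel_smul_comp_eq hA hf hv]
  rw [integral_smul]
  exact pow_finrank_smul_integral_comp_of_norm_map (L := (A v : E →ₗ[ℝ] E))
    (norm_pos_iff.2 hv) (hA v) fun y => scaleKernel (Module.finrank ℝ V) ‖v‖ ‖y‖ • f y • ψ y

theorem integral_smul_nonneg_of_integral_comp_nonneg {ψ : E → ℂ}
    (hA : ∀ v x, ‖A v x‖ = ‖v‖ * ‖x‖)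
    (hf : ∀ v x, ‖v‖ ^ Module.finrank ℝ E * f (A v x) = ‖v‖ ^ Module.finrank ℝ V * f x)
    (hfm : Measurable f) (hf0 : ∀ x, 0 ≤ f x) (hψ : Continuous ψ)
    (hfψ : Integrable fun x => f x • ψ x) (hpos : ∀ x ≠ 0, 0 ≤ ∫ v, ψ (A v x) ∂μ) :
    0 ≤ ∫ x, f x • ψ x := by
  have hball : 0 < μ.real (Metric.ball 0 1) :=
    ENNReal.toReal_pos (Metric.measure_ball_pos μ 0 one_pos).ne' measure_ball_lt_top.ne
  rw [← smul_nonneg_iff_nonneg_of_pos_left hball,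
    ← integral_scaleKernel_smul_integral_comp hA hf hfm hψ hfψ]
  refine integral_nonneg_of_ae ?_
  filter_upwards [Measure.ae_ne volume 0] with x hx
  exact smul_nonneg (scaleKernel_nonneg _ _ (norm_nonneg x)) (smul_nonneg (hf0 x) (hpos x hx))

end Homogeneous

theorem isPositiveDefiniteDistribution_of_homogeneous {V E : Type*} [NormedAddCommGroup V]
    [NormedSpace ℝ V] [FiniteDimensional ℝ V] [Nontrivial V] [NormedAddCommGroup E]
    [InnerProductSpace ℝ E] [FiniteDimensional ℝ E] [Nontrivial E] [MeasurableSpace E]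
    [BorelSpace E] {A : V →L[ℝ] E →L[ℝ] E} {f : E → ℝ} {T : 𝓢'(E, ℂ)}
    (hA : ∀ v x, ‖A v x‖ = ‖v‖ * ‖x‖)
    (hf : ∀ v x, ‖v‖ ^ Module.finrank ℝ E * f (A v x) = ‖v‖ ^ Module.finrank ℝ V * f x)
    (hfm : Measurable f) (hf0 : ∀ x, 0 ≤ f x) (hT : IsRepresentedBy T f) :
    IsPositiveDefiniteDistribution T := by
  intro φ
  borelize V
  obtain ⟨hint, hTφ⟩ := hT (autoConvolution φ)
  simp only [← Complex.real_smul] at hint hTφ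
  rw [hTφ]
  refine integral_smul_nonneg_of_integral_comp_nonneg (μ := Measure.addHaar) hA hf hfm hf0
    (autoConvolution φ).continuous hint fun x hx => ?_
  refine integral_autoConvolution_comp_nonneg φ (L := (A.flip x : V →ₗ[ℝ] E)) ?_
  refine (injective_iff_map_eq_zero _).2 fun v hv => ?_
  simpa [hx] using (hA v x).symm.trans (norm_eq_zero.2 hv)

section Temperedness

variable {E : Type*} [NormedAddCommGroup E]

theorem integrable_mul_one_add_norm_of_norm_le_rpow [NormedSpace ℝ E] [FiniteDimensional ℝ E]
    [MeasurableSpace E] [BorelSpace E] {μ : Measure E} [μ.IsAddHaarMeasure]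
    {f : E → ℝ} {C α : ℝ} (hα0 : 0 ≤ α) (hα : α < Module.finrank ℝ E)
    (hfm : AEStronglyMeasurable f μ) (hfC : ∀ x, ‖f x‖ ≤ C * ‖x‖ ^ (-α)) :
    Integrable (fun x => f x * (1 + ‖x‖) ^ (-((Module.finrank ℝ E + 1 : ℕ) : ℝ))) μ := by
  have hdim : 1 ≤ Module.finrank ℝ E := by exact_mod_cast hα0.trans_lt hα
  have hnear : Integrable ((Metric.ball 0 1).indicator fun x => ‖f x‖) μ :=
    (integrable_indicator_iff measurableSet_ball).2
      (integrableOn_ball_of_norm_le_rpow hdim hα (.of_forall hfC) hfm).norm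
  let w : E → ℝ := fun x => (1 + ‖x‖) ^ (-((Module.finrank ℝ E + 1 : ℕ) : ℝ))
  have hw : Integrable w μ := integrable_one_add_norm (by push_cast; linarith)
  refine (hnear.add (hw.const_mul |C|)).mono' (hfm.mul hw.aestronglyMeasurable)
    (.of_forall fun x => ?_)
  have hwx : 0 ≤ w x := by positivity
  rw [norm_mul, Real.norm_of_nonneg hwx, Pi.add_apply]
  by_cases hx : x ∈ Metric.ball 0 1
  · rw [Set.indicator_of_mem hx]
    have hwx1 : w x ≤ 1 := Real.rpow_le_one_of_one_le_of_nonpos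
      (le_add_of_nonneg_right (norm_nonneg x)) (neg_nonpos.2 (Nat.cast_nonneg _))
    exact le_add_of_le_of_nonneg (mul_le_of_le_one_right (norm_nonneg _) hwx1) (by positivity)
  · rw [Set.indicator_of_notMem hx, zero_add]
    have hx1 : 1 ≤ ‖x‖ := by simpa using hx
    gcongr
    calc ‖f x‖ ≤ C * ‖x‖ ^ (-α) := hfC x
      _ ≤ |C| * 1 := mul_le_mul (le_abs_self C)
          (Real.rpow_le_one_of_one_le_of_nonpos hx1 (neg_nonpos.2 hα0)) (by positivity)
          (abs_nonneg C)
      _ = |C| := mul_one _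

variable [InnerProductSpace ℝ E] [FiniteDimensional ℝ E] [MeasurableSpace E] [BorelSpace E]
  {f : E → ℝ}

theorem exists_isRepresentedBy_of_integrable (hfm : Measurable f) (hf0 : ∀ x, 0 ≤ f x) {n : ℕ}
    (hf : Integrable fun x => f x * (1 + ‖x‖) ^ (-(n : ℝ))) :
    ∃ T : 𝓢'(E, ℂ), IsRepresentedBy T f := by
  let μ : Measure E := volume.withDensity fun x => ((f x).toNNReal : ENNReal)
  have hμ : μ.HasTemperateGrowth := by
    refine ⟨n, (integrable_withDensity_iff_integrable_smul hfm.real_toNNReal).2 ?_⟩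
    simpa only [NNReal.smul_def, Real.coe_toNNReal _ (hf0 _), smul_eq_mul] using hf
  have hsmul (φ : 𝓢(E, ℂ)) (x : E) : (f x).toNNReal • φ x = (f x : ℂ) * φ x := by
    rw [NNReal.smul_def, Real.coe_toNNReal _ (hf0 x), Complex.real_smul]
  refine ⟨μ.toTemperedDistribution, fun φ => ⟨?_, ?_⟩⟩
  · simpa only [hsmul] using
      (integrable_withDensity_iff_integrable_smul hfm.real_toNNReal).1 (φ.integrable (μ := μ))
  · rw [Measure.toTemperedDistribution_apply μ φ,
      integral_withDensity_eq_integral_smul hfm.real_toNNReal]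
    simp only [hsmul]

theorem exists_isRepresentedBy_of_le_rpow {C α : ℝ} (hα0 : 0 ≤ α) (hα : α < Module.finrank ℝ E)
    (hfm : Measurable f) (hf0 : ∀ x, 0 ≤ f x) (hfC : ∀ x, f x ≤ C * ‖x‖ ^ (-α)) :
    ∃ T : 𝓢'(E, ℂ), IsRepresentedBy T f :=
  exists_isRepresentedBy_of_integrable hfm hf0 <|
    integrable_mul_one_add_norm_of_norm_le_rpow hα0 hα hfm.aestronglyMeasurable fun x =>
      (Real.norm_of_nonneg (hf0 x)).trans_le (hfC x)

end Temperedness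

section Gauge

theorem lowerSemicontinuous_gauge {E : Type*} [AddCommGroup E] [Module ℝ E] [TopologicalSpace E]
    [ContinuousSMul ℝ E] [T2Space E] {K : Set E} (hK : IsCompact K) (habs : Absorbent ℝ K) :
    LowerSemicontinuous (gauge K) := by
  refine lowerSemicontinuous_iff_isClosed_preimage.2 fun a => ?_
  have hsub : gauge K ⁻¹' Set.Iic a =
      ⋂ ε > 0, (fun p : ℝ × E => p.1 • p.2) '' Set.Icc 0 (a + ε) ×ˢ K := by
    ext x
    simp only [Set.mem_preimage, Set.mem_Iic, Set.mem_iInter]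
    constructor
    · intro hx ε hε
      obtain ⟨b, hb0, hb, y, hy, rfl⟩ :=
        exists_lt_of_gauge_lt habs (hx.trans_lt (lt_add_of_pos_right a hε))
      exact ⟨(b, y), ⟨⟨hb0.le, hb.le⟩, hy⟩, rfl⟩
    · refine fun hx => le_of_forall_pos_le_add fun ε hε => ?_
      obtain ⟨⟨b, y⟩, ⟨⟨hb0, hb⟩, hy⟩, rfl⟩ := hx ε hε
      exact (gauge_le_of_mem hb0 (Set.smul_mem_smul_set hy)).trans hb
  rw [hsub]
  exact isClosed_biInter fun ε _ =>
    ((isCompact_Icc.prod hK).image continuous_smul).isClosed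

theorem exists_one_lt_forall_mul_norm_le_gauge {E : Type*} [NormedAddCommGroup E]
    [NormedSpace ℝ E] [ProperSpace E] {K : Set E} (hK : IsClosed K) (habs : Absorbent ℝ K)
    (hball : K ⊆ Metric.ball 0 1) : ∃ c > 1, ∀ x, c * ‖x‖ ≤ gauge K x := by
  obtain ⟨r, ⟨hr0, hr1⟩, hKr⟩ := exists_pos_lt_subset_ball one_pos hK hball
  refine ⟨r⁻¹, (one_lt_inv₀ hr0).2 hr1, fun x => ?_⟩
  rw [inv_mul_eq_div]
  exact le_gauge_of_subset_closedBall habs hr0.le (hKr.trans Metric.ball_subset_closedBall)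

end Gauge

section Density

variable {K : Set R4}

theorem hyperbolicDensity_eq_inv {x : R4} (hx : ‖x‖ ≤ gauge K x) :
    hyperbolicDensity K x = (gauge K x ^ 2 - ‖x‖ ^ 2)⁻¹ := by
  rw [hyperbolicDensity, zpow_neg, zpow_ofNat]
  obtain h0 | h0 := eq_or_ne (gauge K x) 0
  · have hx0 : ‖x‖ = 0 := le_antisymm (h0 ▸ hx) (norm_nonneg x)
    simp [h0, hx0]
  · field_simp

theorem hyperbolicDensity_nonneg {x : R4} (hx : ‖x‖ ≤ gauge K x) : 0 ≤ hyperbolicDensity K x := by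
  rw [hyperbolicDensity_eq_inv hx, inv_nonneg, sub_nonneg]
  gcongr

theorem hyperbolicDensity_le {c : ℝ} (hc : 1 < c) {x : R4} (hx : c * ‖x‖ ≤ gauge K x) :
    hyperbolicDensity K x ≤ (c ^ 2 - 1)⁻¹ * ‖x‖ ^ (-2 : ℝ) := by
  have hle : ‖x‖ ≤ gauge K x := (le_mul_of_one_le_left (norm_nonneg x) hc.le).trans hx
  rw [hyperbolicDensity_eq_inv hle, Real.rpow_neg (norm_nonneg x), Real.rpow_two, ← mul_inv]
  obtain rfl | hx0 := eq_or_ne x 0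
  · simp
  · have hc2 : 0 < c ^ 2 - 1 := by nlinarith
    have hsq : (c * ‖x‖) ^ 2 ≤ gauge K x ^ 2 := by gcongr
    exact inv_anti₀ (by positivity) (by linarith)

theorem measurable_hyperbolicDensity (hK : IsCompact K) (habs : Absorbent ℝ K) :
    Measurable (hyperbolicDensity K) := by
  have hgauge : Measurable (gauge K) := (lowerSemicontinuous_gauge hK habs).measurable
  unfold hyperbolicDensity
  fun_prop

end Density

section ComplexStructure

/-- Multiplication by `i` on `ℝ⁴ ≅ ℂ²`. -/
noncomputable def mulI : R4 →L[ℝ] R4 :=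
  LinearMap.toContinuousLinearMap
    { toFun x := !₂[-x 1, x 0, -x 3, x 2]
      map_add' x y := by ext i; fin_cases i <;> simp [add_comm]
      map_smul' a x := by ext i; fin_cases i <;> simp }

/-- The scalar multiplication of `ℂ` on `ℝ⁴ ≅ ℂ²`, as a real bilinear map. -/
noncomputable def complexMul : ℂ →L[ℝ] R4 →L[ℝ] R4 :=
  Complex.reCLM.smulRight (.id ℝ R4) + Complex.imCLM.smulRight mulI

theorem complexMul_apply (z : ℂ) (x : R4) :
    complexMul z x = !₂[z.re * x 0 - z.im * x 1, z.im * x 0 + z.re * x 1,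
      z.re * x 2 - z.im * x 3, z.im * x 2 + z.re * x 3] := by
  ext i
  fin_cases i <;> simp [complexMul, mulI] <;> ring

theorem norm_complexMul (z : ℂ) (x : R4) : ‖complexMul z x‖ = ‖z‖ * ‖x‖ := by
  rw [← sq_eq_sq₀ (norm_nonneg _) (by positivity), mul_pow, complexMul_apply,
    EuclideanSpace.real_norm_sq_eq, EuclideanSpace.real_norm_sq_eq, Complex.sq_norm,
    Complex.normSq_apply]
  simp only [Fin.sum_univ_four, Matrix.cons_val_zero, Matrix.cons_val_one, Matrix.cons_val]
  ring

theorem complexMul_eq_rotTheta (z : ℂ) (x : R4) :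
    complexMul z x = rotTheta z.arg (‖z‖ • x) := by
  rw [complexMul_apply, rotTheta, ← Complex.norm_mul_cos_arg z, ← Complex.norm_mul_sin_arg z]
  ext i
  fin_cases i <;> simp [-Complex.norm_mul_cos_arg, -Complex.norm_mul_sin_arg] <;> ring

variable {K : Set R4}

theorem IsRThetaInvariant.gauge_rotTheta (hK : IsRThetaInvariant K) (θ : ℝ) (x : R4) :
    gauge K (rotTheta θ x) = gauge K x := by
  have hper : Function.Periodic (fun θ => rotTheta θ x) (2 * Real.pi) := fun θ => by
    simp only [rotTheta, Real.cos_add_two_pi, Real.sin_add_two_pi]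
  obtain ⟨θ', hθ', h⟩ := hper.exists_mem_Ico₀ Real.two_pi_pos θ
  exact (congrArg (gauge K) h).trans (hK θ' (Set.Ico_subset_Icc_self hθ') x)

theorem IsRThetaInvariant.gauge_complexMul (hK : IsRThetaInvariant K) (z : ℂ) (x : R4) :
    gauge K (complexMul z x) = ‖z‖ * gauge K x := by
  rw [complexMul_eq_rotTheta, hK.gauge_rotTheta, gauge_smul_of_nonneg (norm_nonneg z), smul_eq_mul]

theorem IsRThetaInvariant.pow_four_mul_hyperbolicDensity (hK : IsRThetaInvariant K)
    (hle : ∀ x, ‖x‖ ≤ gauge K x) (z : ℂ) (x : R4) :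
    ‖z‖ ^ 4 * hyperbolicDensity K (complexMul z x) = ‖z‖ ^ 2 * hyperbolicDensity K x := by
  rw [hyperbolicDensity_eq_inv (hle _), hyperbolicDensity_eq_inv (hle _), hK.gauge_complexMul,
    norm_complexMul, mul_pow, mul_pow, ← mul_sub, mul_inv, ← mul_assoc]
  obtain h0 | h0 := eq_or_ne ‖z‖ 0
  · simp [h0]
  · field_simp

end ComplexStructure

theorem lemma8_general (K : Set R4) (hK : IsCompact K) (habs : Absorbent ℝ K)
    (hinv : IsRThetaInvariant K) (hball : K ⊆ Metric.ball (0 : R4) 1) :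
    ∃ T : 𝓢'(R4, ℂ), IsRepresentedBy T (hyperbolicDensity K) ∧
      IsPositiveDefiniteDistribution T := by
  obtain ⟨c, hc, hgauge⟩ := exists_one_lt_forall_mul_norm_le_gauge hK.isClosed habs hball
  have hle (x : R4) : ‖x‖ ≤ gauge K x :=
    (le_mul_of_one_le_left (norm_nonneg x) hc.le).trans (hgauge x)
  have hmeas : Measurable (hyperbolicDensity K) := measurable_hyperbolicDensity hK habs
  have hnonneg (x : R4) : 0 ≤ hyperbolicDensity K x := hyperbolicDensity_nonneg (hle x)
  have hbound (x : R4) : hyperbolicDensity K x ≤ (c ^ 2 - 1)⁻¹ * ‖x‖ ^ (-2 : ℝ) :=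
    hyperbolicDensity_le hc (hgauge x)
  obtain ⟨T, hT⟩ := exists_isRepresentedBy_of_le_rpow zero_le_two (by norm_num) hmeas hnonneg hbound
  refine ⟨T, hT, isPositiveDefiniteDistribution_of_homogeneous norm_complexMul ?_ hmeas hnonneg hT⟩
  simpa only [finrank_euclideanSpace_fin, Complex.finrank_real_complex] using
    hinv.pow_four_mul_hyperbolicDensity hle

theorem lemma8 (K : Set R4) (hK : IsStarBody K) (hinv : IsRThetaInvariant K)
    (hball : K ⊆ Metric.ball (0 : R4) 1) :
    ∃ T : 𝓢'(R4, ℂ), IsRepresentedBy T (hyperbolicDensity K) ∧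
      IsPositiveDefiniteDistribution T :=
  lemma8_general K hK.isCompact
    (absorbent_nhds_zero (mem_interior_iff_mem_nhds.1 hK.zero_mem_interior)) hinv hball
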